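/- \textbf{Conventions.} A \emph{q.n.c. tomonoid} is a commutative monoid $(\mathcal L;\odot,1)$ with a total order $\le$ compatible with $\odot$, such that $a\le 1$ for all $a$, every non-empty subset has a supremum, and $a\odot\bigvee_\iota b_\iota=\bigvee_\iota(a\odot b_\iota)$ for all non-empty families. A \emph{filter} $F$ of $\mathcal L$ is an upward closed submonoid; it induces the congruence $\sim_F$, where $a\sim_F b$ if $a=b$, or $a<b$ and $b\odot f\le a$ for some $f\in F$, or $b<a$ and $a\odot f\le b$ for some $f\in F$. Its classes are the \emph{$F$-classes}. $F$ is \emph{Archimedean} if for all $a,b\in F$ with $a<b<1$ there is $n\ge1$ with $b^n\le a$. $F$ is \emph{Łukasiewicz} if it is isomorphic, as an ordered monoid, to $[0,1]$ with the operation $(a,b)\mapsto(a+b-1)\vee0$, and \emph{product} if it is isomorphic to $(0,1]$ with multiplication. For an $F$-class $R$ and $f\in F$ let $\lambda_f^R\colon R\to R$, $r\mapsto f\odot r$, let $\Lambda^R=\{\lambda^R_f: f\in F\}$ (a composition tomonoid: a set of order-preserving self-maps of $R$, closed under composition, containing the identity and totally ordered pointwise), and let $\rho_R\colon F\to\Lambda^R$,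 $f\mapsto\lambda^R_f$, which is a surjective homomorphism. A \emph{c-isomorphism} from a composition tomonoid $\Phi$ on a chain $R$ to one $\Psi$ on a chain $S$ is an order isomorphism $\phi\colon R\to S$ with $\Psi=\{\phi\circ\lambda\circ\phi^{-1}:\lambda\in\Phi\}$. A composition tomonoid is \emph{Łukasiewicz}, \emph{product}, \emph{reversed product}, or \emph{power} if it is c-isomorphic to, respectively, $\{x\mapsto(x+t-1)\vee0: t\in[0,1]\}$ on $[0,1]$, $\{x\mapsto tx:t\in(0,1]\}$ on $(0,1]$, $\{x\mapsto\frac{(x+t-1)\vee0}{t}:t\in(0,1]\}$ on $[0,1)$, or $\{x\mapsto x^{1/t}:t\in(0,1]\}$ on $(0,1)$. \textbf{Theorem.} Let $\mathcal L$ be a q.n.c. tomonoid and $F\ne\{1\}$ an Archimedean filter of $\mathcal L$ such that each $F$-class is order-isomorphic to a real interval (a one-element set, or $(a,b)$, $(a,b]$, $[a,b)$ or $[a,b]$ with real $a<b$). Let $R$ be an $F$-class that is not a singleton. Below, if $F$ is Łukasiewicz (product), it is identified with $[0,1]$ (with $(0,1]$) by an arbitrary isomorphism of ordered monoids as above, and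 $R$ is identified with the respective real interval by an arbitrary c-isomorphism from $\Lambda^R$ to the respective standard composition tomonoid; the constant $\alpha$ may depend on these identifications. (i) If $F$ is Łukasiewicz, then $\Lambda^R$ is Łukasiewicz, and there is an $\alpha\ge1$ such that, under the identification of $R$ with $[0,1]$, $\rho_R(f)(r)=(r+\alpha(f-1))\vee0$ for all $f\in F$, $r\in[0,1]$. (ii) If $F$ is product and $\Lambda^R$ is Łukasiewicz, then there is an $\alpha>0$ such that, under the identification of $R$ with $[0,1]$, $\rho_R(f)(r)=(r+\alpha\ln f)\vee0$ for all $f\in F$, $r\in[0,1]$. (iii) If $F$ is product and $\Lambda^R$ is product, then there is an $\alpha>0$ such that, under the identification of $R$ with $(0,1]$, $\rho_R(f)(r)=f^\alpha r$ for all $f\in F$, $r\in(0,1]$. (iv) If $F$ is product and $\Lambda^R$ is reversed product, then there is an $\alpha>0$ such that, under the identification of $R$ with $[0,1)$, $\rho_R(f)(r)=\bigl(1-\frac{1-r}{f^\alpha}\bigr)\vee0$ for all $f\in F$, $r\in[0,1)$. (v) If $F$ is product and $\Lambda^R$ is power, then there is an $\alpha>0$ such that, under the identification of $R$ with $(0,1)$,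 $\rho_R(f)(r)=r^{1/f^\alpha}$ for all $f\in F$, $r\in(0,1)$. -/

import Mathlib

namespace Tomonoid

universe u v

/-- Quantic, negative, commutative totally ordered monoids. -/
class IsQNC (L : Type u) [CommMonoid L] [LinearOrder L] : Prop extends IsOrderedMonoid L where
  /-- negativity -/
  le_one' : ∀ a : L, a ≤ 1
  /-- almost completeness -/
  exists_isLUB : ∀ S : Set L, S.Nonempty → ∃ b, IsLUB S b
  /-- multiplication distributes over existing suprema -/
  isLUB_mul : ∀ (a : L) (S : Set L) (b : L), S.Nonempty → IsLUB S b →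
    IsLUB ((fun x => a * x) '' S) (a * b)

/-- A tomonoid is Archimedean if for all `a < b < 1` some power of `b` lies below `a`. -/
def IsArchimedean (L : Type u) [CommMonoid L] [LinearOrder L] : Prop :=
  ∀ a b : L, a < b → b < 1 → ∃ n : ℕ, 1 ≤ n ∧ b ^ n ≤ a

/-- A filter: an upward closed submonoid. -/
structure TFilter (L : Type u) [CommMonoid L] [LinearOrder L] extends Submonoid L where
  mem_of_le' : ∀ {f g : L}, f ∈ carrier → f ≤ g → g ∈ carrier

/-- Real intervals: singletons, and the bounded intervals of `ℝ` with endpoints `a < b`. -/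
def IsRealInterval (I : Set ℝ) : Prop :=
  (∃ a, I = {a}) ∨
    ∃ a b : ℝ, a < b ∧
      (I = Set.Ioo a b ∨ I = Set.Ioc a b ∨ I = Set.Ico a b ∨ I = Set.Icc a b)

section Congruence

variable {L : Type u} [CommMonoid L] [LinearOrder L]

/-- The relation `a ∼_F b` induced by a filter `F`. -/
def TFilter.Rel (F : TFilter L) (a b : L) : Prop :=
  a = b ∨ (a < b ∧ ∃ f ∈ F.toSubmonoid, b * f ≤ a) ∨ (b < a ∧ ∃ f ∈ F.toSubmonoid, a * f ≤ b)

theorem TFilter.rel_iff (F : TFilter L) (a b : L) :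
    F.Rel a b ↔ (∃ f ∈ F.toSubmonoid, b * f ≤ a) ∧ (∃ f ∈ F.toSubmonoid, a * f ≤ b) := by
  constructor
  · rintro (rfl | ⟨h, hf⟩ | ⟨h, hf⟩)
    · exact ⟨⟨1, F.one_mem', by simp⟩, ⟨1, F.one_mem', by simp⟩⟩
    · exact ⟨hf, ⟨1, F.one_mem', by simpa using h.le⟩⟩
    · exact ⟨⟨1, F.one_mem', by simpa using h.le⟩, hf⟩
  · rintro ⟨h1, h2⟩
    rcases lt_trichotomy a b with h | h | h
    · exact Or.inr (Or.inl ⟨h, h1⟩)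
    · exact Or.inl h
    · exact Or.inr (Or.inr ⟨h, h2⟩)

variable [IsQNC L]

theorem mul_le_self' (a f : L) : a * f ≤ a := by
  have h : a * f ≤ a * 1 := mul_le_mul_right (IsQNC.le_one' f) a
  rwa [mul_one] at h

/-- The congruence `∼_F` of the monoid `L`. -/
def TFilter.con (F : TFilter L) : Con L where
  r := F.Rel
  iseqv := by
    have key : ∀ a b c : L, (∃ f ∈ F.toSubmonoid, b * f ≤ a) →
        (∃ f ∈ F.toSubmonoid, c * f ≤ b) → ∃ f ∈ F.toSubmonoid, c * f ≤ a := by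
      rintro a b c ⟨f, hf, h⟩ ⟨g, hg, h'⟩
      refine ⟨g * f, F.toSubmonoid.mul_mem hg hf, ?_⟩
      rw [← mul_assoc]
      exact (mul_le_mul_left h' f).trans h
    refine ⟨fun a => Or.inl rfl, fun {a b} h => ?_, fun {a b c} h h' => ?_⟩
    · rw [F.rel_iff] at h ⊢
      exact ⟨h.2, h.1⟩
    · rw [F.rel_iff] at h h' ⊢
      exact ⟨key a b c h.1 h'.1, key c b a h'.2 h.2⟩
  mul' := by
    have key : ∀ a b c d : L, (∃ f ∈ F.toSubmonoid, b * f ≤ a) →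
        (∃ f ∈ F.toSubmonoid, d * f ≤ c) → ∃ f ∈ F.toSubmonoid, b * d * f ≤ a * c := by
      rintro a b c d ⟨f, hf, h⟩ ⟨g, hg, h'⟩
      refine ⟨f * g, F.toSubmonoid.mul_mem hf hg, ?_⟩
      rw [mul_mul_mul_comm]
      exact mul_le_mul' h h'
    intro a b c d h h'
    change F.Rel a b at h
    change F.Rel c d at h'
    rw [F.rel_iff] at h h' ⊢
    exact ⟨key a b c d h.1 h'.1, key b a d c h.2 h'.2⟩

/-- The (underlying monoid of the) quotient `P` of `L` by `F`. -/
abbrev TFilter.Quot (F : TFilter L) : Type u := F.con.Quotient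

/-- An element `R` of the quotient, viewed as a subset of `L`, that is, as an `F`-class. -/
def TFilter.cls (F : TFilter L) (R : F.Quot) : Set L := {a | (a : F.con.Quotient) = R}

/-- `L` is an Archimedean real coextension of its quotient by `F`: `F` is Archimedean and each
`F`-class is order isomorphic to a real interval. -/
structure IsArchimedeanRealCoextension (F : TFilter L) : Prop where
  archimedean : IsArchimedean F.toSubmonoid
  real : ∀ R : F.Quot, ∃ I : Set ℝ, IsRealInterval I ∧ Nonempty (F.cls R ≃o I)

theorem TFilter.mul_mem_cls (F : TFilter L) (R : F.Quot) {f r : L} (hf : f ∈ F.toSubmonoid)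
    (hr : r ∈ F.cls R) : f * r ∈ F.cls R := by
  have h : F.Rel (f * r) r := by
    rw [F.rel_iff]
    exact ⟨⟨f, hf, (mul_comm r f).le⟩, ⟨1, F.one_mem', by
      rw [mul_one, mul_comm]; exact mul_le_self' r f⟩⟩
  have h' : ((f * r : L) : F.con.Quotient) = (r : F.con.Quotient) := (Con.eq F.con).2 h
  exact h'.trans hr

end Congruence

/-- A composition tomonoid on a chain `R`: a set of order-preserving mappings of `R` to itself that
is closed under composition, contains the identity and is totally ordered pointwise. (The monoid
operation of `R →o R` is composition and its order is the pointwise one.) -/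
structure CompositionTomonoid (R : Type u) [LinearOrder R] extends Submonoid (R →o R) where
  total' : ∀ φ ∈ carrier, ∀ ψ ∈ carrier, φ ≤ ψ ∨ ψ ≤ φ

/-- The order isomorphism `φ : R ≃o S` is a c-isomorphism from `Φ` to `Ψ`:
`Ψ = {φ ∘ l ∘ φ⁻¹ | l ∈ Φ}`. -/
def IsCIso {R : Type u} {S : Type v} [LinearOrder R] [LinearOrder S] (φ : R ≃o S)
    (Φ : CompositionTomonoid R) (Ψ : CompositionTomonoid S) : Prop :=
  (Ψ.carrier : Set (S →o S)) =
    {g | ∃ l ∈ Φ.carrier, ∀ s : S, g s = φ (l (φ.symm s))}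

/-- `Φ` and `Ψ` are c-isomorphic. -/
def CIsomorphic {R : Type u} {S : Type v} [LinearOrder R] [LinearOrder S]
    (Φ : CompositionTomonoid R) (Ψ : CompositionTomonoid S) : Prop :=
  ∃ φ : R ≃o S, IsCIso φ Φ Ψ

section Translations

variable {L : Type u} [CommMonoid L] [LinearOrder L] [IsQNC L]

/-- The map `f ↦ λ_f^R` sending `f ∈ F` to the restriction to `R` of the translation
`x ↦ f ⊙ x`. -/
def TFilter.translation (F : TFilter L) (R : F.Quot) :
    F.toSubmonoid →* (F.cls R →o F.cls R) where
  toFun f :=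
    { toFun := fun r => ⟨(f : L) * (r : L), F.mul_mem_cls R f.2 r.2⟩
      monotone' := fun _ _ h => mul_le_mul_right (α := L) h (f : L) }
  map_one' := by
    apply OrderHom.ext
    funext r
    exact Subtype.ext (one_mul (r : L))
  map_mul' f g := by
    apply OrderHom.ext
    funext r
    exact Subtype.ext (mul_assoc (f : L) (g : L) (r : L))

theorem TFilter.translation_mono (F : TFilter L) (R : F.Quot) :
    Monotone (F.translation R) :=
  fun _ _ h r => mul_le_mul_left (α := L) h (r : L)

/-- The composition tomonoid `Λ^R = {λ_f^R | f ∈ F}` on the `F`-class `R`. -/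
def TFilter.Lambda (F : TFilter L) (R : F.Quot) : CompositionTomonoid (F.cls R) where
  toSubmonoid := MonoidHom.mrange (F.translation R)
  total' := by
    rintro _ ⟨f, rfl⟩ _ ⟨g, rfl⟩
    exact (le_total f g).imp (fun h => F.translation_mono R h) (fun h => F.translation_mono R h)

/-- The homomorphism `ρ_R : F → Λ^R`, `f ↦ λ_f^R`. -/
def TFilter.rho (F : TFilter L) (R : F.Quot) :
    F.toSubmonoid →*o (F.Lambda R).toSubmonoid where
  toMonoidHom := (F.translation R).mrangeRestrict
  monotone' := fun _ _ h => F.translation_mono R h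

theorem TFilter.rho_surjective (F : TFilter L) (R : F.Quot) : Function.Surjective (F.rho R) :=
  (F.translation R).mrangeRestrict_surjective

end Translations

section Standard

/-- The closed unit interval, as the base set of the Łukasiewicz tomonoid. -/
def Luk : Type := Set.Icc (0 : ℝ) 1

noncomputable instance : LinearOrder Luk := inferInstanceAs (LinearOrder (Set.Icc (0 : ℝ) 1))

/-- The underlying real number. -/
def Luk.val (a : Luk) : ℝ := Subtype.val a

/-- The Łukasiewicz t-norm `(a, b) ↦ (a + b - 1) ∨ 0` on the unit interval. -/
noncomputable instance : CommMonoid Luk where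
  mul a b := ⟨max (a.1 + b.1 - 1) 0, le_max_right _ _,
    max_le (by linarith [a.2.2, b.2.2]) zero_le_one⟩
  one := ⟨1, zero_le_one, le_rfl⟩
  mul_assoc a b c := by
    apply Subtype.ext
    change max (max (a.1 + b.1 - 1) 0 + c.1 - 1) 0 = max (a.1 + max (b.1 + c.1 - 1) 0 - 1) 0
    have ha := a.2.2
    have hc := c.2.2
    simp only [max_def]
    split_ifs <;> linarith
  one_mul a := by
    apply Subtype.ext
    change max (1 + a.1 - 1) 0 = a.1
    rw [add_sub_cancel_left]
    exact max_eq_left a.2.1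
  mul_one a := by
    apply Subtype.ext
    change max (a.1 + 1 - 1) 0 = a.1
    rw [add_sub_cancel_right]
    exact max_eq_left a.2.1
  mul_comm a b := by
    apply Subtype.ext
    change max (a.1 + b.1 - 1) 0 = max (b.1 + a.1 - 1) 0
    rw [add_comm]

/-- A tomonoid is a Łukasiewicz tomonoid if it is isomorphic to `([0,1]; ≤, ⋆, 1)`. -/
def IsLukasiewicz (L : Type u) [CommMonoid L] [LinearOrder L] : Prop := Nonempty (L ≃*o Luk)

/-- `x ↦ (x + t - 1) ∨ 0` on `[0,1]`. -/
noncomputable def lukMap (t : Set.Icc (0 : ℝ) 1) : Set.Icc (0 : ℝ) 1 →o Set.Icc (0 : ℝ) 1 where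
  toFun x := ⟨max (x.1 + t.1 - 1) 0, le_max_right _ _,
    max_le (by linarith [x.2.2, t.2.2]) zero_le_one⟩
  monotone' x y h := by
    have h' : x.1 ≤ y.1 := h
    change max (x.1 + t.1 - 1) 0 ≤ max (y.1 + t.1 - 1) 0
    gcongr

/-- `x ↦ t * x` on `(0,1]`. -/
noncomputable def prodMap (t : Set.Ioc (0 : ℝ) 1) : Set.Ioc (0 : ℝ) 1 →o Set.Ioc (0 : ℝ) 1 where
  toFun x := ⟨t.1 * x.1, mul_pos t.2.1 x.2.1, mul_le_one₀ t.2.2 x.2.1.le x.2.2⟩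
  monotone' x y h := by
    have h' : x.1 ≤ y.1 := h
    have ht := t.2.1
    change t.1 * x.1 ≤ t.1 * y.1
    gcongr

/-- `x ↦ ((x + t - 1) ∨ 0) / t` on `[0,1)`. -/
noncomputable def revProdMap (t : Set.Ioc (0 : ℝ) 1) :
    Set.Ico (0 : ℝ) 1 →o Set.Ico (0 : ℝ) 1 where
  toFun x := ⟨max (x.1 + t.1 - 1) 0 / t.1, div_nonneg (le_max_right _ _) t.2.1.le, by
    rw [div_lt_one t.2.1]
    exact max_lt (by linarith [x.2.2]) t.2.1⟩
  monotone' x y h := by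
    have h' : x.1 ≤ y.1 := h
    have ht := t.2.1
    change max (x.1 + t.1 - 1) 0 / t.1 ≤ max (y.1 + t.1 - 1) 0 / t.1
    gcongr

/-- `x ↦ x ^ (1 / t)` on `(0,1)`. -/
noncomputable def powMap (t : Set.Ioc (0 : ℝ) 1) :
    Set.Ioo (0 : ℝ) 1 →o Set.Ioo (0 : ℝ) 1 where
  toFun x := ⟨x.1 ^ (1 / t.1), Real.rpow_pos_of_pos x.2.1 _,
    Real.rpow_lt_one x.2.1.le x.2.2 (one_div_pos.2 t.2.1)⟩
  monotone' x _ h := Real.rpow_le_rpow x.2.1.le h (one_div_pos.2 t.2.1).le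

/-- The standard Łukasiewicz composition tomonoid on `[0,1]`. -/
noncomputable def PhiLuk : CompositionTomonoid (Set.Icc (0 : ℝ) 1) where
  carrier := Set.range lukMap
  one_mem' := ⟨⟨1, zero_le_one, le_rfl⟩, by
    apply OrderHom.ext; funext x; apply Subtype.ext
    change max (x.1 + 1 - 1) 0 = x.1
    rw [add_sub_cancel_right]; exact max_eq_left x.2.1⟩
  mul_mem' := by
    rintro _ _ ⟨s, rfl⟩ ⟨t, rfl⟩
    refine ⟨⟨max (s.1 + t.1 - 1) 0, le_max_right _ _,
      max_le (by linarith [s.2.2, t.2.2]) zero_le_one⟩, ?_⟩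
    apply OrderHom.ext; funext x; apply Subtype.ext
    change max (x.1 + max (s.1 + t.1 - 1) 0 - 1) 0 = max (max (x.1 + t.1 - 1) 0 + s.1 - 1) 0
    have hs := s.2.2
    have hx := x.2.2
    simp only [max_def]
    split_ifs <;> linarith
  total' := by
    have key : ∀ s t : Set.Icc (0 : ℝ) 1, s ≤ t → lukMap s ≤ lukMap t := by
      intro s t h x
      have h' : s.1 ≤ t.1 := h
      change max (x.1 + s.1 - 1) 0 ≤ max (x.1 + t.1 - 1) 0
      gcongr
    rintro _ ⟨s, rfl⟩ _ ⟨t, rfl⟩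
    exact (le_total s t).imp (key s t) (key t s)

/-- The standard product composition tomonoid on `(0,1]`. -/
noncomputable def PhiProd : CompositionTomonoid (Set.Ioc (0 : ℝ) 1) where
  carrier := Set.range prodMap
  one_mem' := ⟨1, by
    apply OrderHom.ext; funext x; apply Subtype.ext
    exact one_mul x.1⟩
  mul_mem' := by
    rintro _ _ ⟨s, rfl⟩ ⟨t, rfl⟩
    refine ⟨s * t, ?_⟩
    apply OrderHom.ext; funext x; apply Subtype.ext
    exact mul_assoc s.1 t.1 x.1
  total' := by
    have key : ∀ s t : Set.Ioc (0 : ℝ) 1, s ≤ t → prodMap s ≤ prodMap t := by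
      intro s t h x
      have h' : s.1 ≤ t.1 := h
      have hx := x.2.1
      change s.1 * x.1 ≤ t.1 * x.1
      gcongr
    rintro _ ⟨s, rfl⟩ _ ⟨t, rfl⟩
    exact (le_total s t).imp (key s t) (key t s)

theorem revProd_aux {t : ℝ} (ht : 0 < t) (x : ℝ) :
    max (x + t - 1) 0 / t = max (1 - (1 - x) / t) 0 := by
  rw [← max_div_div_right ht.le, zero_div]
  congr 1
  field_simp
  ring

/-- The standard reversed product composition tomonoid on `[0,1)`. -/
noncomputable def PhiRevProd : CompositionTomonoid (Set.Ico (0 : ℝ) 1) where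
  carrier := Set.range revProdMap
  one_mem' := ⟨1, by
    apply OrderHom.ext; funext x; apply Subtype.ext
    change max (x.1 + 1 - 1) 0 / 1 = x.1
    rw [add_sub_cancel_right, div_one]; exact max_eq_left x.2.1⟩
  mul_mem' := by
    rintro _ _ ⟨s, rfl⟩ ⟨t, rfl⟩
    refine ⟨s * t, ?_⟩
    apply OrderHom.ext; funext x; apply Subtype.ext
    change max (x.1 + s.1 * t.1 - 1) 0 / (s.1 * t.1) =
      max (max (x.1 + t.1 - 1) 0 / t.1 + s.1 - 1) 0 / s.1
    have hs := s.2.1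
    have ht := t.2.1
    rw [revProd_aux (mul_pos hs ht), revProd_aux hs, revProd_aux ht]
    rcases le_total (1 - (1 - x.1) / t.1) 0 with h | h
    · rw [max_eq_right h]
      have h1 : (1 : ℝ) ≤ (1 - x.1) / t.1 := by linarith
      have h2 : (1 : ℝ) ≤ (1 - 0) / s.1 := by
        rw [sub_zero]; exact (one_le_div hs).2 s.2.2
      have h3 : (1 : ℝ) ≤ (1 - x.1) / (s.1 * t.1) := by
        rw [one_le_div (mul_pos hs ht)]
        rw [one_le_div ht] at h1
        nlinarith [s.2.2]
      rw [max_eq_right (by linarith), max_eq_right (by linarith)]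
    · rw [max_eq_left h]
      congr 2
      field_simp
      ring
  total' := by
    have key : ∀ s t : Set.Ioc (0 : ℝ) 1, s ≤ t → revProdMap s ≤ revProdMap t := by
      intro s t h x
      have h' : s.1 ≤ t.1 := h
      have hx : 0 ≤ 1 - x.1 := by linarith [x.2.2]
      have hs := s.2.1
      change max (x.1 + s.1 - 1) 0 / s.1 ≤ max (x.1 + t.1 - 1) 0 / t.1
      rw [revProd_aux hs, revProd_aux t.2.1]
      gcongr
    rintro _ ⟨s, rfl⟩ _ ⟨t, rfl⟩
    exact (le_total s t).imp (key s t) (key t s)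

/-- The standard power composition tomonoid on `(0,1)`. -/
noncomputable def PhiPow : CompositionTomonoid (Set.Ioo (0 : ℝ) 1) where
  carrier := Set.range powMap
  one_mem' := ⟨1, by
    apply OrderHom.ext; funext x; apply Subtype.ext
    change x.1 ^ (1 / (1 : ℝ)) = x.1
    rw [div_one, Real.rpow_one]⟩
  mul_mem' := by
    rintro _ _ ⟨s, rfl⟩ ⟨t, rfl⟩
    refine ⟨s * t, ?_⟩
    apply OrderHom.ext; funext x; apply Subtype.ext
    change x.1 ^ (1 / (s.1 * t.1)) = (x.1 ^ (1 / t.1)) ^ (1 / s.1)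
    rw [← Real.rpow_mul x.2.1.le]
    congr 1
    rw [one_div_mul_one_div, mul_comm]
  total' := by
    have key : ∀ s t : Set.Ioc (0 : ℝ) 1, s ≤ t → powMap s ≤ powMap t := by
      intro s t h x
      exact Real.rpow_le_rpow_of_exponent_ge x.2.1 x.2.2.le (one_div_le_one_div_of_le s.2.1 h)
    rintro _ ⟨s, rfl⟩ _ ⟨t, rfl⟩
    exact (le_total s t).imp (key s t) (key t s)

end Standard

/-- A composition tomonoid is Łukasiewicz. -/
def CompositionTomonoid.IsLuk {R : Type u} [LinearOrder R] (Φ : CompositionTomonoid R) : Prop :=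
  CIsomorphic Φ PhiLuk

end Tomonoid

/-! A c-isomorphism turns `Λ^R` into a standard family of maps in which distinct parameters give
distinct maps, ordered like their parameters. Reading off the parameter therefore turns `ρ_R` into a
surjective monotone homomorphism between standard tomonoids (`IsCIso.exists_hom`). In the
coordinates `u = 1 - x` (Łukasiewicz) or `u = -ln x` (product), such a homomorphism is a monotone
solution of Cauchy's equation on `u ≥ 0`, truncated when the target is Łukasiewicz. It is thus
linear up to truncation (`truncated_additive_eq`, `monotone_additive_eq`), and its slope is `α`.

The remaining claim is that `Λ^R` is Łukasiewicz whenever `F` is (`TFilter.Lambda_isLuk`). The least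
element `z` of `F` forces `R` to have a greatest element `b` and the least element `z * b`. Each `r`
in `R` equals `g * b` for a largest `g` in `F` (`TFilter.exists_residual`). These residuals form a
segment `[k, 1]` of `F`, on which `f` acts by multiplication truncated at `k`; an affine rescaling
of that segment to `[0,1]` is the required c-isomorphism. -/

namespace Tomonoid

universe u v w

/-! ### Monotone solutions of Cauchy's equation, with and without truncation -/

section Cauchy

theorem truncated_additive_nsmul {σ : ℝ → ℝ} {K : ℝ} (hK : 0 < K) (h0 : σ 0 = 0)
    (hnn : ∀ u, 0 ≤ u → 0 ≤ σ u)
    (hadd : ∀ u v, 0 ≤ u → 0 ≤ v → σ (u + v) = min (σ u + σ v) K)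
    {u : ℝ} (hu : 0 ≤ u) (n : ℕ) : σ (n * u) = min (n * σ u) K := by
  induction n with
  | zero => simp [h0, hK.le]
  | succ n ih =>
    have h := hadd (n * u) u (by positivity) hu
    have h1 := hnn u hu
    push_cast
    rw [add_mul, add_mul, one_mul, one_mul, h, ih]
    rcases le_total (n * σ u) K with h2 | h2
    · rw [min_eq_left h2]
    · rw [min_eq_right h2, min_eq_right (by linarith), min_eq_right (by linarith)]

/-- Monotone solutions of the Cauchy equation on the nonnegative reals, truncated at `K`. -/
theorem truncated_additive_eq {σ : ℝ → ℝ} {K : ℝ} (hK : 0 < K) (h0 : σ 0 = 0)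
    (hnn : ∀ u, 0 ≤ u → 0 ≤ σ u)
    (hmono : ∀ u v, 0 ≤ u → u ≤ v → σ u ≤ σ v)
    (hadd : ∀ u v, 0 ≤ u → 0 ≤ v → σ (u + v) = min (σ u + σ v) K)
    {c : ℝ} (hc : 0 < c) (hcK : σ c < K) {u : ℝ} (hu : 0 ≤ u) :
    σ u = min (σ c / c * u) K := by
  have hs : 0 ≤ σ c := hnn c hc.le
  have key : ∀ n : ℕ, 0 < n → |σ u - min (σ c / c * u) K| ≤ σ c / n := by
    intro n hn
    have hn' : (0 : ℝ) < n := by exact_mod_cast hn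
    -- Since `σ c < K`, the truncation is not active at `c`, so the value at `c` can be divided by
    -- `n`.
    have hd : σ (c / n) = σ c / n := by
      have h := truncated_additive_nsmul hK h0 hnn hadd (u := c / n) (by positivity) n
      rw [mul_div_cancel₀ _ hn'.ne'] at h
      rcases le_total (n * σ (c / n)) K with h2 | h2
      · rw [min_eq_left h2] at h
        rw [h]; field_simp
      · rw [min_eq_right h2] at h
        exact absurd h hcK.ne
    -- Squeeze `u` between consecutive multiples of `c / n`; monotonicity then leaves an error of at
    -- most `σ c / n`, which tends to `0`.
    set m := ⌊u / (c / n)⌋₊ with hm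
    have hcn : 0 < c / n := by positivity
    have h1 : (m : ℝ) * (c / n) ≤ u := by
      rw [← le_div_iff₀ hcn]; exact Nat.floor_le (by positivity)
    have h2 : u ≤ ((m + 1 : ℕ) : ℝ) * (c / n) := by
      rw [← div_le_iff₀ hcn]; push_cast; exact (Nat.lt_floor_add_one _).le
    have h3 := hmono _ _ (by positivity) h1
    have h4 := hmono _ _ hu h2
    rw [truncated_additive_nsmul hK h0 hnn hadd hcn.le, hd] at h3 h4
    have hα : 0 ≤ σ c / c := by positivity
    have h5 : (m : ℝ) * (σ c / n) ≤ σ c / c * u := by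
      calc (m : ℝ) * (σ c / n) = σ c / c * (m * (c / n)) := by field_simp
        _ ≤ _ := by gcongr
    have h6 : σ c / c * u ≤ (m : ℝ) * (σ c / n) + σ c / n := by
      calc σ c / c * u ≤ σ c / c * (((m + 1 : ℕ) : ℝ) * (c / n)) := by gcongr
        _ = _ := by push_cast; field_simp
    push_cast at h4
    rw [add_mul, one_mul] at h4
    have h7 : 0 ≤ σ c / n := by positivity
    rw [abs_le]
    constructor
    · have : min (σ c / c * u) K ≤ min (m * (σ c / n)) K + σ c / n := by
        rw [← min_add_add_right]
        exact min_le_min h6 (by linarith)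
      linarith
    · have : min (m * (σ c / n) + σ c / n) K ≤ min (m * (σ c / n)) K + σ c / n := by
        rw [← min_add_add_right]
        exact min_le_min le_rfl (by linarith)
      have : min (m * (σ c / n)) K ≤ min (σ c / c * u) K := min_le_min h5 le_rfl
      linarith
  have hlim : Filter.Tendsto (fun n : ℕ => σ c / (n : ℝ)) Filter.atTop (nhds 0) :=
    tendsto_const_div_atTop_nhds_zero_nat _
  have hle : |σ u - min (σ c / c * u) K| ≤ 0 := by
    refine ge_of_tendsto hlim ?_
    filter_upwards [Filter.eventually_gt_atTop 0] with n hn using key n hn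
  exact sub_eq_zero.1 (abs_nonpos_iff.1 hle)

/-- Monotone solutions of the Cauchy equation on the nonnegative reals. -/
theorem monotone_additive_eq {σ : ℝ → ℝ}
    (hnn : ∀ u, 0 ≤ u → 0 ≤ σ u)
    (hmono : ∀ u v, 0 ≤ u → u ≤ v → σ u ≤ σ v)
    (hadd : ∀ u v, 0 ≤ u → 0 ≤ v → σ (u + v) = σ u + σ v)
    {c : ℝ} (hc : 0 < c) {u : ℝ} (hu : 0 ≤ u) : σ u = σ c / c * u := by
  have h0 : σ 0 = 0 := by
    have := hadd 0 0 le_rfl le_rfl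
    rw [add_zero] at this
    linarith
  have hsc := hnn c hc.le
  have hsu := hnn u hu
  -- Truncating above both `σ c` and `σ u` changes neither value, so the truncated case applies.
  obtain ⟨K, hK⟩ : ∃ K, K = σ c + σ u + 1 := ⟨_, rfl⟩
  have hK0 : 0 < K := by linarith
  have hc' : min (σ c) K = σ c := min_eq_left (by linarith)
  have hu' : min (σ u) K = σ u := min_eq_left (by linarith)
  have h := truncated_additive_eq (σ := fun u => min (σ u) K) hK0 (by simp [h0, hK0.le])
    (fun u hu => le_min (hnn u hu) hK0.le)
    (fun u v hu huv => min_le_min (hmono u v hu huv) le_rfl)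
    (fun u v hu hv => by
      have h1 := hnn u hu
      have h2 := hnn v hv
      simp only [hadd u v hu hv, min_def]
      split_ifs <;> linarith) hc (by rw [hc']; linarith) hu
  simp only [hc', hu'] at h
  rcases le_total (σ c / c * u) K with h2 | h2
  · rwa [min_eq_left h2] at h
  · rw [min_eq_right h2] at h
    linarith

end Cauchy

/-! ### Surjective monotone homomorphisms between the standard tomonoids -/

section Luk

theorem Luk.val_nonneg (a : Luk) : 0 ≤ a.val := a.2.1

theorem Luk.val_le_one (a : Luk) : a.val ≤ 1 := a.2.2

theorem Luk.val_mul (a b : Luk) : (a * b).val = max (a.val + b.val - 1) 0 := rfl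

theorem Luk.val_one : (1 : Luk).val = 1 := rfl

theorem Luk.val_le_val {a b : Luk} : a.val ≤ b.val ↔ a ≤ b := Iff.rfl

theorem Luk.val_lt_val {a b : Luk} : a.val < b.val ↔ a < b := Iff.rfl

theorem Luk.val_injective : Function.Injective Luk.val := Subtype.val_injective

theorem Luk.exists_val_eq {x : ℝ} (h0 : 0 ≤ x) (h1 : x ≤ 1) : ∃ a : Luk, a.val = x :=
  ⟨⟨x, h0, h1⟩, rfl⟩

/-- A surjective monotone homomorphism onto the Łukasiewicz tomonoid, composed with a
parametrisation of its domain by the nonnegative reals, is linear up to truncation. -/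
theorem exists_eq_truncated_linear {T : Type u} [Mul T] [LinearOrder T] {τ : T → Luk}
    (hs : Function.Surjective τ) (hm : Monotone τ) (hmul : ∀ a b, τ (a * b) = τ a * τ b)
    {p : ℝ → T} (hp : ∀ t, ∃ u, 0 ≤ u ∧ p u = t) (hpa : ∀ u v, 0 ≤ u → u ≤ v → p v ≤ p u)
    (hpm : ∀ u v, 0 ≤ u → 0 ≤ v → p (u + v) = p u * p v) :
    ∃ α : ℝ, 0 < α ∧ ∀ u, 0 ≤ u → (τ (p u)).val = max (1 - α * u) 0 := by
  -- Under `x ↦ 1 - x` the Łukasiewicz product becomes addition truncated at `1`.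
  obtain ⟨σ, hσ⟩ : ∃ σ : ℝ → ℝ, ∀ u, σ u = 1 - (τ (p u)).val := ⟨_, fun _ => rfl⟩
  have hmono : ∀ u v, 0 ≤ u → u ≤ v → σ u ≤ σ v := by
    intro u v hu huv
    rw [hσ, hσ]
    have := Luk.val_le_val.2 (hm (hpa u v hu huv))
    linarith
  have hadd : ∀ u v, 0 ≤ u → 0 ≤ v → σ (u + v) = min (σ u + σ v) 1 := by
    intro u v hu hv
    rw [hσ, hσ, hσ, hpm u v hu hv, hmul, Luk.val_mul, max_def, min_def]
    split_ifs <;> linarith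
  have hex : ∀ x : ℝ, 0 ≤ x → x ≤ 1 → ∃ u, 0 ≤ u ∧ σ u = x := by
    intro x h0 h1
    obtain ⟨a, ha⟩ := Luk.exists_val_eq (x := 1 - x) (by linarith) (by linarith)
    obtain ⟨t, rfl⟩ := hs a
    obtain ⟨u, hu, rfl⟩ := hp t
    exact ⟨u, hu, by rw [hσ, ha]; ring⟩
  have hnn : ∀ u, 0 ≤ u → 0 ≤ σ u := fun u _ => by
    rw [hσ]; linarith [(τ (p u)).val_le_one]
  -- Truncated additivity alone would also permit `σ 0 = 1`; surjectivity excludes it.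
  have h0 : σ 0 = 0 := by
    obtain ⟨u, hu, h⟩ := hex 0 le_rfl zero_le_one
    exact le_antisymm (h ▸ hmono 0 u le_rfl hu) (hnn 0 le_rfl)
  -- Any value strictly between `0` and `1` would do: positive for a nonzero slope, below `1` to
  -- stay clear of the truncation.
  obtain ⟨c, hc, hcσ⟩ := hex (1 / 2) (by norm_num) (by norm_num)
  have hc' : 0 < c := by
    rcases hc.eq_or_lt with rfl | h
    · rw [h0] at hcσ; norm_num at hcσ
    · exact h
  refine ⟨σ c / c, by rw [hcσ]; positivity, fun u hu => ?_⟩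
  have h := truncated_additive_eq one_pos h0 hnn hmono hadd hc' (by rw [hcσ]; norm_num) hu
  have h' : (τ (p u)).val = 1 - σ u := by rw [hσ]; ring
  rw [h', h, max_def, min_def]
  split_ifs <;> linarith

/-- The parametrisation `u ↦ (1 - u) ∨ 0` is not injective, but it carries addition to the
Łukasiewicz product, which is all that is needed. The bound `1 ≤ α` holds because a monotone
surjection sends the least element to the least element. -/
theorem exists_luk_hom_eq {τ : Luk → Luk} (hs : Function.Surjective τ) (hm : Monotone τ)
    (hmul : ∀ a b, τ (a * b) = τ a * τ b) :
    ∃ α : ℝ, 1 ≤ α ∧ ∀ x : Luk, (τ x).val = max (1 + α * (x.val - 1)) 0 := by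
  have hpe : ∀ u : ℝ, ∃ a : Luk, 0 ≤ u → a.val = max (1 - u) 0 := by
    intro u
    by_cases hu : 0 ≤ u
    · obtain ⟨a, ha⟩ := Luk.exists_val_eq (x := max (1 - u) 0) (le_max_right _ _)
        (max_le (by linarith) zero_le_one)
      exact ⟨a, fun _ => ha⟩
    -- A default value: negative `u` never matter.
    · exact ⟨1, fun h => absurd h hu⟩
  choose p hpv using hpe
  have hp1 : ∀ x : Luk, p (1 - x.val) = x := by
    intro x
    apply Luk.val_injective
    rw [hpv _ (by linarith [x.val_le_one]), sub_sub_cancel, max_eq_left x.val_nonneg]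
  obtain ⟨α, hα, h⟩ := exists_eq_truncated_linear hs hm hmul (p := p)
    (fun x => ⟨1 - x.val, by linarith [x.val_le_one], hp1 x⟩)
    (fun u v hu huv => by
      rw [← Luk.val_le_val, hpv u hu, hpv v (hu.trans huv)]
      gcongr)
    (fun u v hu hv => by
      apply Luk.val_injective
      rw [Luk.val_mul, hpv u hu, hpv v hv, hpv _ (add_nonneg hu hv)]
      simp only [max_def]
      split_ifs <;> linarith)
  have h' : ∀ x : Luk, (τ x).val = max (1 + α * (x.val - 1)) 0 := by
    intro x
    have := h (1 - x.val) (by linarith [x.val_le_one])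
    rw [hp1] at this
    rw [this]
    congr 1
    ring
  refine ⟨α, ?_, h'⟩
  obtain ⟨z, hz⟩ := Luk.exists_val_eq le_rfl zero_le_one
  obtain ⟨x, hx⟩ := hs z
  have h1 : (τ z).val ≤ (τ x).val :=
    Luk.val_le_val.2 (hm (Luk.val_le_val.1 (hz.trans_le x.val_nonneg)))
  rw [hx, h', hz] at h1
  have := (le_max_left _ _).trans h1
  linarith

theorem neg_log_nonneg_and_exp (x : Set.Ioc (0 : ℝ) 1) :
    0 ≤ -Real.log x ∧ Real.exp (-(-Real.log x)) = x := by
  refine ⟨neg_nonneg.2 (Real.log_nonpos x.2.1.le x.2.2), ?_⟩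
  rw [neg_neg, Real.exp_log x.2.1]

theorem exists_exp_param : ∃ p : ℝ → Set.Ioc (0 : ℝ) 1, ∀ u, 0 ≤ u → (p u : ℝ) = Real.exp (-u) := by
  have hpe : ∀ u : ℝ, ∃ a : Set.Ioc (0 : ℝ) 1, 0 ≤ u → (a : ℝ) = Real.exp (-u) := by
    intro u
    by_cases hu : 0 ≤ u
    · exact ⟨⟨Real.exp (-u), Real.exp_pos _, Real.exp_le_one_iff.2 (by linarith)⟩, fun _ => rfl⟩
    · exact ⟨1, fun h => absurd h hu⟩
  choose p hp using hpe
  exact ⟨p, hp⟩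

theorem exists_prod_luk_hom_eq {τ : Set.Ioc (0 : ℝ) 1 → Luk} (hs : Function.Surjective τ)
    (hm : Monotone τ) (hmul : ∀ a b, τ (a * b) = τ a * τ b) :
    ∃ α : ℝ, 0 < α ∧ ∀ x : Set.Ioc (0 : ℝ) 1, (τ x).val = max (1 + α * Real.log x) 0 := by
  obtain ⟨p, hpv⟩ := exists_exp_param
  have hp1 : ∀ x : Set.Ioc (0 : ℝ) 1, p (-Real.log x) = x := by
    intro x
    apply Subtype.ext
    rw [hpv _ (neg_log_nonneg_and_exp x).1, (neg_log_nonneg_and_exp x).2]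
  obtain ⟨α, hα, h⟩ := exists_eq_truncated_linear hs hm hmul (p := p)
    (fun x => ⟨-Real.log x, (neg_log_nonneg_and_exp x).1, hp1 x⟩)
    (fun u v hu huv => by
      rw [← Subtype.coe_le_coe, hpv u hu, hpv v (hu.trans huv)]
      gcongr)
    (fun u v hu hv => by
      apply Subtype.ext
      rw [Set.Ioc.coe_mul, hpv u hu, hpv v hv, hpv _ (add_nonneg hu hv), ← Real.exp_add]
      congr 1
      ring)
  refine ⟨α, hα, fun x => ?_⟩
  have := h (-Real.log x) (neg_log_nonneg_and_exp x).1
  rw [hp1] at this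
  rw [this]
  congr 1
  ring

/-- Taking `-ln` on both sides gives the untruncated Cauchy equation; the linear solution of slope
`α` exponentiates to `x ^ α`. -/
theorem exists_prod_hom_eq {τ : Set.Ioc (0 : ℝ) 1 → Set.Ioc (0 : ℝ) 1}
    (hs : Function.Surjective τ) (hm : Monotone τ) (hmul : ∀ a b, τ (a * b) = τ a * τ b) :
    ∃ α : ℝ, 0 < α ∧ ∀ x : Set.Ioc (0 : ℝ) 1, (τ x : ℝ) = (x : ℝ) ^ α := by
  obtain ⟨p, hpv⟩ := exists_exp_param
  have hp1 : ∀ x : Set.Ioc (0 : ℝ) 1, p (-Real.log x) = x := by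
    intro x
    apply Subtype.ext
    rw [hpv _ (neg_log_nonneg_and_exp x).1, (neg_log_nonneg_and_exp x).2]
  obtain ⟨σ, hσ⟩ : ∃ σ : ℝ → ℝ, ∀ u, σ u = -Real.log (τ (p u)) := ⟨_, fun _ => rfl⟩
  have hnn : ∀ u, 0 ≤ u → 0 ≤ σ u := fun u _ => by
    rw [hσ]; exact (neg_log_nonneg_and_exp _).1
  have hmono : ∀ u v, 0 ≤ u → u ≤ v → σ u ≤ σ v := by
    intro u v hu huv
    rw [hσ, hσ]
    have h1 : p v ≤ p u := by
      rw [← Subtype.coe_le_coe, hpv u hu, hpv v (hu.trans huv)]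
      gcongr
    exact neg_le_neg (Real.log_le_log (τ (p v)).2.1 (hm h1))
  have hadd : ∀ u v, 0 ≤ u → 0 ≤ v → σ (u + v) = σ u + σ v := by
    intro u v hu hv
    have h1 : p (u + v) = p u * p v := by
      apply Subtype.ext
      rw [Set.Ioc.coe_mul, hpv u hu, hpv v hv, hpv _ (add_nonneg hu hv), ← Real.exp_add]
      congr 1
      ring
    rw [hσ, hσ, hσ, h1, hmul, Set.Ioc.coe_mul,
      Real.log_mul (τ (p u)).2.1.ne' (τ (p v)).2.1.ne']
    ring
  -- Any value other than `1` would do: it provides a point where `σ` is nonzero, hence a positive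
  -- slope.
  obtain ⟨x, hx⟩ := hs ⟨1 / 2, by norm_num, by norm_num⟩
  have hxσ : σ (-Real.log x) = Real.log 2 := by
    rw [hσ, hp1, hx]
    simp
  have hl2 : 0 < Real.log 2 := Real.log_pos one_lt_two
  have hc : 0 < -Real.log x := by
    rcases (neg_log_nonneg_and_exp x).1.eq_or_lt with h | h
    · have := hadd 0 0 le_rfl le_rfl
      rw [← h] at hxσ
      rw [add_zero, hxσ] at this
      linarith
    · exact h
  refine ⟨σ (-Real.log x) / -Real.log x, by rw [hxσ]; positivity, fun y => ?_⟩
  have h := monotone_additive_eq hnn hmono hadd hc (neg_log_nonneg_and_exp y).1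
  rw [hσ (-Real.log y), hp1] at h
  rw [Real.rpow_def_of_pos y.2.1, ← Real.exp_log (τ y).2.1]
  congr 1
  linarith

end Luk

/-! ### From a c-isomorphism to a homomorphism into the parameters -/

section Conjugation

variable {L : Type u} [CommMonoid L] [LinearOrder L] [IsQNC L]

/-- If `Λ^R` is c-isomorphic to a composition tomonoid faithfully parametrised by `T`, then `ρ_R`
becomes a surjective monotone homomorphism to `T`. -/
theorem IsCIso.exists_hom {F : TFilter L} {R : F.Quot} {S : Type v} [LinearOrder S]
    {T : Type w} [Mul T] [LinearOrder T] {m : T → (S →o S)}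
    (hmul : ∀ s t, m (s * t) = m s * m t) (hle : ∀ s t, m s ≤ m t → s ≤ t)
    {Ψ : CompositionTomonoid S} (hΨ : Ψ.carrier = Set.range m) {φ : F.cls R ≃o S}
    (h : IsCIso φ (F.Lambda R) Ψ) :
    ∃ τ : F.toSubmonoid → T, Function.Surjective τ ∧ Monotone τ ∧
      (∀ f g, τ (f * g) = τ f * τ g) ∧
      ∀ f s, φ ((F.rho R f).1 (φ.symm s)) = m (τ f) s := by
  have hinj : ∀ s t, m s = m t → s = t := fun s t h => (hle s t h.le).antisymm (hle t s h.ge)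
  unfold IsCIso at h
  rw [hΨ] at h
  -- The c-isomorphism only equates two sets of maps; the order and the product of the chosen
  -- parameters are recovered from `hle`, `hinj` and `hmul`.
  have hex : ∀ f : F.toSubmonoid, ∃ t : T, ∀ s, φ ((F.rho R f).1 (φ.symm s)) = m t s := by
    intro f
    have hmem : (⟨fun s => φ ((F.rho R f).1 (φ.symm s)), fun s t hst =>
        φ.monotone ((F.rho R f).1.monotone (φ.symm.monotone hst))⟩ : S →o S) ∈ Set.range m := by
      rw [h]
      exact ⟨(F.rho R f).1, (F.rho R f).2, fun s => rfl⟩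
    obtain ⟨t, ht⟩ := hmem
    exact ⟨t, fun s => by rw [ht]; rfl⟩
  choose τ hτ using hex
  refine ⟨τ, ?_, ?_, ?_, hτ⟩
  · intro t
    have ht : m t ∈ Set.range m := ⟨t, rfl⟩
    rw [h] at ht
    obtain ⟨l, ⟨f, rfl⟩, hl⟩ := ht
    refine ⟨f, hinj _ _ ?_⟩
    apply OrderHom.ext
    funext s
    rw [← hτ, hl]
    rfl
  · intro f g hfg
    refine hle _ _ fun s => ?_
    rw [← hτ, ← hτ]
    exact φ.monotone ((F.rho R).monotone' hfg _)
  · intro f g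
    refine hinj _ _ ?_
    rw [hmul]
    apply OrderHom.ext
    funext s
    change m (τ (f * g)) s = m (τ f) (m (τ g) s)
    rw [← hτ, ← hτ, ← hτ, OrderIso.symm_apply_apply, map_mul]
    rfl

end Conjugation

/-! ### Faithful multiplicative parametrisations of the standard composition tomonoids -/

section Parametrisation

/-- The maps of `PhiLuk`, parametrised by the Łukasiewicz tomonoid. -/
noncomputable def lukParam (t : Luk) : Set.Icc (0 : ℝ) 1 →o Set.Icc (0 : ℝ) 1 :=
  lukMap ⟨t.val, t.val_nonneg, t.val_le_one⟩

theorem lukParam_apply (t : Luk) (x : Set.Icc (0 : ℝ) 1) :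
    (lukParam t x : ℝ) = max ((x : ℝ) + t.val - 1) 0 := rfl

theorem carrier_PhiLuk : PhiLuk.carrier = Set.range lukParam := by
  ext g
  constructor
  · rintro ⟨t, rfl⟩
    obtain ⟨a, ha⟩ := Luk.exists_val_eq t.2.1 t.2.2
    exact ⟨a, by rw [lukParam]; congr 1; exact Subtype.ext ha⟩
  · rintro ⟨t, rfl⟩
    exact ⟨_, rfl⟩

theorem lukParam_mul (s t : Luk) : lukParam (s * t) = lukParam s * lukParam t := by
  apply OrderHom.ext; funext x; apply Subtype.ext
  change max (x.1 + max (s.val + t.val - 1) 0 - 1) 0 =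
    max (max (x.1 + t.val - 1) 0 + s.val - 1) 0
  have hs := s.val_le_one
  have hx := x.2.2
  simp only [max_def]
  split_ifs <;> linarith

theorem le_of_lukParam_le (s t : Luk) (h : lukParam s ≤ lukParam t) : s ≤ t := by
  have h1 : max (1 + s.val - 1) 0 ≤ max (1 + t.val - 1) 0 := h ⟨1, zero_le_one, le_rfl⟩
  rw [add_sub_cancel_left, add_sub_cancel_left, max_eq_left s.val_nonneg,
    max_eq_left t.val_nonneg] at h1
  exact Luk.val_le_val.1 h1

theorem prodMap_mul (s t : Set.Ioc (0 : ℝ) 1) : prodMap (s * t) = prodMap s * prodMap t := by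
  apply OrderHom.ext; funext x; apply Subtype.ext
  exact mul_assoc s.1 t.1 x.1

theorem le_of_prodMap_le (s t : Set.Ioc (0 : ℝ) 1) (h : prodMap s ≤ prodMap t) : s ≤ t := by
  have h1 : s.1 * 1 ≤ t.1 * 1 := h ⟨1, zero_lt_one, le_rfl⟩
  rwa [mul_one, mul_one] at h1

theorem revProdMap_apply (t : Set.Ioc (0 : ℝ) 1) (x : Set.Ico (0 : ℝ) 1) :
    (revProdMap t x : ℝ) = max (1 - (1 - (x : ℝ)) / t) 0 :=
  revProd_aux t.2.1 x

theorem revProdMap_mul (s t : Set.Ioc (0 : ℝ) 1) :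
    revProdMap (s * t) = revProdMap s * revProdMap t := by
  apply OrderHom.ext; funext x; apply Subtype.ext
  change (revProdMap (s * t) x : ℝ) = (revProdMap s (revProdMap t x) : ℝ)
  rw [revProdMap_apply, revProdMap_apply, revProdMap_apply, Set.Ioc.coe_mul]
  have hs := s.2.1
  have ht := t.2.1
  rcases le_total (1 - (1 - (x : ℝ)) / t) 0 with h | h
  · have h1 : (1 : ℝ) ≤ (1 - x) / t := by linarith
    have h2 : (1 : ℝ) ≤ (1 - 0) / s := by
      rw [sub_zero]; exact (one_le_div hs).2 s.2.2
    have h3 : (1 : ℝ) ≤ (1 - x) / (s * t) := by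
      rw [one_le_div (mul_pos hs ht)]
      rw [one_le_div ht] at h1
      exact (mul_le_of_le_one_left ht.le s.2.2).trans h1
    rw [max_eq_right h, max_eq_right (by linarith), max_eq_right (by linarith)]
  · rw [max_eq_left h]
    congr 2
    rw [sub_sub_cancel, div_div, mul_comm (t : ℝ)]

/-- As `[0,1)` has no top element at which to read off the parameter, the test point depends on `s`:
the map of `s` sends `1 - s / 2` to `1 / 2`, away from the truncation. -/
theorem le_of_revProdMap_le (s t : Set.Ioc (0 : ℝ) 1) (h : revProdMap s ≤ revProdMap t) :
    s ≤ t := by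
  have hs := s.2.1
  have ht := t.2.1
  have hs1 := s.2.2
  have h1 : (revProdMap s ⟨1 - s / 2, by linarith, by linarith⟩ : ℝ) ≤
    revProdMap t ⟨1 - s / 2, by linarith, by linarith⟩ := h _
  rw [revProdMap_apply, revProdMap_apply] at h1
  simp only [sub_sub_cancel] at h1
  have h2 : (s : ℝ) / 2 / s = 1 / 2 := by field_simp
  rw [h2] at h1
  have h3 := (le_max_left _ _).trans h1
  have h4 : (1 : ℝ) - 1 / 2 ≤ 1 - (s : ℝ) / 2 / t := by
    rcases le_max_iff.1 h3 with h | h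
    · exact h
    · norm_num at h
  have h5 : (s : ℝ) / 2 / t ≤ 1 / 2 := by linarith
  rw [div_le_iff₀ ht] at h5
  exact Subtype.coe_le_coe.1 (by linarith)

theorem powMap_mul (s t : Set.Ioc (0 : ℝ) 1) : powMap (s * t) = powMap s * powMap t := by
  apply OrderHom.ext; funext x; apply Subtype.ext
  change x.1 ^ (1 / (s.1 * t.1)) = (x.1 ^ (1 / t.1)) ^ (1 / s.1)
  rw [← Real.rpow_mul x.2.1.le]
  congr 1
  rw [one_div_mul_one_div, mul_comm]

theorem le_of_powMap_le (s t : Set.Ioc (0 : ℝ) 1) (h : powMap s ≤ powMap t) : s ≤ t := by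
  have h1 : (1 / 2 : ℝ) ^ (1 / (s : ℝ)) ≤ (1 / 2 : ℝ) ^ (1 / (t : ℝ)) :=
    h ⟨1 / 2, by norm_num, by norm_num⟩
  rw [Real.rpow_le_rpow_left_iff_of_base_lt_one (by norm_num) (by norm_num)] at h1
  exact Subtype.coe_le_coe.1 ((one_div_le_one_div t.2.1 s.2.1).1 h1)

end Parametrisation

/-! ### Classes of a Łukasiewicz filter -/

section Existence

variable {L : Type u} [CommMonoid L] [LinearOrder L] [IsQNC L]

theorem TFilter.mem_cls_iff (F : TFilter L) {R : F.Quot} {r s : L} (hr : r ∈ F.cls R) :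
    s ∈ F.cls R ↔ F.Rel s r := by
  have hr' : (r : F.con.Quotient) = R := hr
  change (s : F.con.Quotient) = R ↔ _
  rw [← hr']
  exact Con.eq F.con

/-- The class of `R` has a least and a greatest element if `F` has a least element. -/
theorem TFilter.exists_isLeast_isGreatest (F : TFilter L) (R : F.Quot) {z : L}
    (hz : z ∈ F.toSubmonoid) (hzl : ∀ f ∈ F.toSubmonoid, z ≤ f) :
    ∃ b ∈ F.cls R, (∀ r ∈ F.cls R, r ≤ b) ∧ (∀ r ∈ F.cls R, z * b ≤ r) := by
  obtain ⟨r₀, hr₀⟩ : ∃ r, r ∈ F.cls R := by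
    induction R using Con.induction_on with
    | H x => exact ⟨x, rfl⟩
  obtain ⟨b, hb⟩ := IsQNC.exists_isLUB (F.cls R) ⟨r₀, hr₀⟩
  -- The least element `z` is a witness for `∼_F` uniformly in the pair, so the bound passes to the
  -- supremum `b` and puts `b` into the class.
  have hzr : ∀ r ∈ F.cls R, ∀ s ∈ F.cls R, z * s ≤ r := by
    intro r hr s hs
    have h := ((F.mem_cls_iff hr).1 hs)
    rw [F.rel_iff] at h
    obtain ⟨-, f, hf, h⟩ := h
    rw [mul_comm]
    exact (mul_le_mul_right (hzl f hf) s).trans h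
  have hzb : ∀ r ∈ F.cls R, z * b ≤ r := by
    intro r hr
    refine (IsQNC.isLUB_mul z _ b ⟨r₀, hr₀⟩ hb).2 ?_
    rintro _ ⟨s, hs, rfl⟩
    exact hzr r hr s hs
  refine ⟨b, ?_, fun r hr => hb.1 hr, hzb⟩
  rw [F.mem_cls_iff hr₀, F.rel_iff]
  refine ⟨⟨1, F.one_mem', by rw [mul_one]; exact hb.1 hr₀⟩, z, hz, ?_⟩
  rw [mul_comm]
  exact hzb r₀ hr₀

/-- Every element below `1` is nilpotent: each factor costs `1 - h`. -/
theorem Luk.exists_pow_le {h : Luk} (hh : h < 1) (x : Luk) : ∃ n : ℕ, h ^ n ≤ x := by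
  have h1 : 0 < 1 - h.val := sub_pos.2 (Luk.val_lt_val.2 hh)
  have hpow : ∀ n : ℕ, (h ^ n).val = max (1 - n * (1 - h.val)) 0 := by
    intro n
    induction n with
    | zero => simp [Luk.val_one]
    | succ n ih =>
      rw [pow_succ, Luk.val_mul, ih]
      have := h.val_le_one
      push_cast
      simp only [max_def]
      split_ifs <;> linarith
  obtain ⟨n, hn⟩ := exists_nat_gt (1 / (1 - h.val))
  rw [div_lt_iff₀ h1] at hn
  refine ⟨n, Luk.val_le_val.1 ?_⟩
  rw [hpow, max_eq_right (by linarith)]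
  exact x.val_nonneg

/-- For a Łukasiewicz filter, translates of the greatest element of a class exhaust the class. -/
theorem TFilter.exists_residual {F : TFilter L} {R : F.Quot} (e : F.toSubmonoid ≃*o Luk)
    {z : F.toSubmonoid} (hz : (e z).val = 0) {b : L}
    (hmax : ∀ r ∈ F.cls R, r ≤ b) (hmin : ∀ r ∈ F.cls R, (z : L) * b ≤ r) (r : F.cls R) :
    ∃ g : F.toSubmonoid, (g : L) * b = r ∧ ∀ f : F.toSubmonoid, (f : L) * b ≤ r → f ≤ g := by
  have hzl : ∀ f : F.toSubmonoid, z ≤ f := fun f =>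
    (map_le_map_iff e).1 (Luk.val_le_val.1 (by rw [hz]; exact (e f).val_nonneg))
  obtain ⟨g, hg⟩ := IsQNC.exists_isLUB {f : L | f ∈ F.toSubmonoid ∧ f * b ≤ r}
    ⟨z, z.2, hmin r r.2⟩
  have hgF : g ∈ F.toSubmonoid := F.mem_of_le' z.2 (hg.1 ⟨z.2, hmin r r.2⟩)
  have hle : g * b ≤ r := by
    rw [mul_comm]
    refine (IsQNC.isLUB_mul b {f : L | f ∈ F.toSubmonoid ∧ f * b ≤ r} g
      ⟨z, z.2, hmin r r.2⟩ hg).2 ?_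
    rintro _ ⟨f, ⟨-, hf⟩, rfl⟩
    change b * f ≤ r
    rwa [mul_comm]
  refine ⟨⟨g, hgF⟩, hle.antisymm ?_, fun f hf => hg.1 ⟨f.2, hf⟩⟩
  by_contra hlt
  rw [not_le] at hlt
  change g * b < r at hlt
  -- some `h < 1` in `F` still moves `r` strictly above `g * b`
  obtain ⟨h, hh1, hhr⟩ : ∃ h : F.toSubmonoid, h < 1 ∧ g * b < r * h := by
    by_contra hcon
    push Not at hcon
    have hne : z < 1 := by
      rcases (hzl 1).eq_or_lt with h | h
      · rw [h, map_one, Luk.val_one] at hz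
        exact absurd hz one_ne_zero
      · exact h
    -- By density of `[0,1]`, `1` is the supremum of the elements of `F` below it. Distributivity
    -- then makes `r` the supremum of the `r * h`, so not all of these can lie below `g * b`.
    have hlub : IsLUB {f : L | ∃ h : F.toSubmonoid, h < 1 ∧ (h : L) = f} 1 := by
      refine ⟨fun f _ => IsQNC.le_one' f, fun c hc => ?_⟩
      have hcF : c ∈ F.toSubmonoid := F.mem_of_le' z.2 (hc ⟨z, hne, rfl⟩)
      have h1 : 1 ≤ (e ⟨c, hcF⟩).val := by
        by_contra hc1
        rw [not_le] at hc1
        have h0 := (e ⟨c, hcF⟩).val_nonneg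
        obtain ⟨a, ha⟩ := Luk.exists_val_eq (x := ((e ⟨c, hcF⟩).val + 1) / 2) (by linarith)
          (by linarith)
        have ha1 : e.symm a < 1 := by
          rw [← map_lt_map_iff e, map_one, OrderMonoidIso.apply_symm_apply, ← Luk.val_lt_val,
            Luk.val_one, ha]
          linarith
        have h2 : e.symm a ≤ ⟨c, hcF⟩ := hc ⟨e.symm a, ha1, rfl⟩
        rw [← map_le_map_iff e, OrderMonoidIso.apply_symm_apply, ← Luk.val_le_val, ha] at h2
        linarith
      have h2 : (1 : F.toSubmonoid) ≤ ⟨c, hcF⟩ := by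
        rw [← map_le_map_iff e, map_one]
        exact Luk.val_le_val.1 h1
      exact h2
    have hr1 : (r : L) * 1 ≤ g * b := by
      refine (IsQNC.isLUB_mul (r : L) {f : L | ∃ h : F.toSubmonoid, h < 1 ∧ (h : L) = f} 1
        ⟨z, z, hne, rfl⟩ hlub).2 ?_
      rintro _ ⟨_, ⟨f, hf, rfl⟩, rfl⟩
      exact hcon f hf
    rw [mul_one] at hr1
    exact absurd hr1 (not_le.2 hlt)
  -- an element of `F` slightly above `g`
  have hgv : (e ⟨g, hgF⟩).val < 1 := by
    by_contra hcon
    rw [not_lt] at hcon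
    have h1 : (1 : F.toSubmonoid) ≤ ⟨g, hgF⟩ := by
      rw [← map_le_map_iff e, map_one]
      exact Luk.val_le_val.1 hcon
    have h2 : (1 : L) ≤ g := h1
    have h3 : 1 * b ≤ g * b := mul_le_mul_left h2 b
    rw [one_mul] at h3
    exact absurd ((hmax r r.2).trans h3) (not_le.2 hlt)
  have hhv : (e h).val < 1 := by
    rw [← Luk.val_one, Luk.val_lt_val, ← map_one e, map_lt_map_iff]
    exact hh1
  have hh0 := (e h).val_nonneg
  have hg0 := (e ⟨g, hgF⟩).val_nonneg
  -- This is the residuum: the largest `a` with `a * h ≤ g`. It exceeds `g` because both `g` and `h`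
  -- lie below `1`.
  obtain ⟨a, ha⟩ := Luk.exists_val_eq
    (x := min 1 ((e ⟨g, hgF⟩).val + (1 - (e h).val))) (le_min zero_le_one (by linarith))
    (min_le_left _ _)
  have hga : (⟨g, hgF⟩ : F.toSubmonoid) < e.symm a := by
    rw [← map_lt_map_iff e, OrderMonoidIso.apply_symm_apply, ← Luk.val_lt_val, ha]
    exact lt_min hgv (by linarith)
  have hah : e.symm a * h ≤ ⟨g, hgF⟩ := by
    rw [← map_le_map_iff e, map_mul, OrderMonoidIso.apply_symm_apply, ← Luk.val_le_val,
      Luk.val_mul, ha]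
    refine max_le ?_ hg0
    have := min_le_right (1 : ℝ) ((e ⟨g, hgF⟩).val + (1 - (e h).val))
    linarith
  have hra : (r : L) ≤ (e.symm a : L) * b := by
    by_contra hcon
    rw [not_le] at hcon
    exact absurd (hg.1 ⟨(e.symm a).2, hcon.le⟩) (not_le.2 hga)
  have h1 : (r : L) * h ≤ g * b := by
    calc (r : L) * h ≤ (e.symm a : L) * b * h := mul_le_mul_left hra _
      _ = (e.symm a * h : L) * b := by rw [mul_right_comm]
      _ ≤ g * b := mul_le_mul_left (α := L) hah b
  exact absurd h1 (not_le.2 hhr)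

/-- Over a Łukasiewicz filter, the composition tomonoid of a nontrivial class is Łukasiewicz. -/
theorem TFilter.Lambda_isLuk {F : TFilter L} {R : F.Quot} (hR : ¬ ∃ a, F.cls R = {a})
    (e : F.toSubmonoid ≃*o Luk) : (F.Lambda R).IsLuk := by
  obtain ⟨z₀, hz₀⟩ := Luk.exists_val_eq le_rfl zero_le_one
  obtain ⟨z, hz⟩ : ∃ z : F.toSubmonoid, (e z).val = 0 :=
    ⟨e.symm z₀, by rw [OrderMonoidIso.apply_symm_apply, hz₀]⟩
  have hzl : ∀ f : F.toSubmonoid, z ≤ f := fun f =>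
    (map_le_map_iff e).1 (Luk.val_le_val.1 (by rw [hz]; exact (e f).val_nonneg))
  obtain ⟨b, hb, hmax, hmin⟩ := F.exists_isLeast_isGreatest R z.2 (fun f hf => hzl ⟨f, hf⟩)
  have hmR : (z : L) * b ∈ F.cls R := F.mul_mem_cls R z.2 hb
  choose res hres hresl using F.exists_residual e hz hmax hmin
  -- `k` is the largest element acting on `b` like `z`.
  set k := res ⟨z * b, hmR⟩ with hk
  have hkb : (k : L) * b = z * b := hres ⟨z * b, hmR⟩
  have hres_le : ∀ r s, res r ≤ res s ↔ r ≤ s := by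
    intro r s
    constructor
    · intro h
      have h1 : (res r : L) * b ≤ res s * b := mul_le_mul_left (α := L) h b
      rw [hres, hres] at h1
      exact h1
    · intro h
      exact hresl s _ ((hres r).trans_le h)
  have hkres : ∀ r, k ≤ res r := fun r => (hres_le _ _).2 (hmin r r.2)
  -- Above `k`, `f` is recovered from `f * b`. If `f < g` and `f * b = g * b`, write `f = a * g`
  -- with `a < 1`: then `a` fixes `g * b`, and so do its powers, which reach `z`. Hence `g * b = z *
  -- b`, contradicting `k < g`.
  have hres_eq : ∀ (f : F.toSubmonoid) (hf : (f : L) * b ∈ F.cls R),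
      res ⟨f * b, hf⟩ = max f k := by
    intro f hf
    rcases le_or_gt f k with h | h
    · rw [max_eq_right h]
      have h1 : (f : L) * b = z * b := by
        refine le_antisymm ?_ (hmin _ hf)
        rw [← hkb]
        exact mul_le_mul_left (α := L) h b
      rw [hk]
      congr 1
      exact Subtype.ext h1
    · rw [max_eq_left h.le]
      refine le_antisymm ?_ (hresl _ f le_rfl)
      by_contra hlt
      rw [not_le] at hlt
      set g := res ⟨f * b, hf⟩ with hg
      have hgb : (g : L) * b = f * b := hres ⟨f * b, hf⟩
      have hfg : (e f).val < (e g).val := Luk.val_lt_val.2 ((map_lt_map_iff e).2 hlt)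
      have hf0 := (e f).val_nonneg
      have hg1 := (e g).val_le_one
      obtain ⟨a, ha⟩ := Luk.exists_val_eq (x := 1 - ((e g).val - (e f).val)) (by linarith)
        (by linarith)
      have hga : f = e.symm a * g := by
        apply EquivLike.injective e
        apply Luk.val_injective
        rw [map_mul, OrderMonoidIso.apply_symm_apply, Luk.val_mul, ha, max_eq_left] <;> linarith
      have hpow : ∀ n : ℕ, ((e.symm a) ^ n : L) * (g * b) = g * b := by
        intro n
        induction n with
        | zero => rw [pow_zero, one_mul]
        | succ n ih =>
          have h1 : (e.symm a : L) * (g * b) = g * b := by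
            rw [← mul_assoc, hgb]
            exact congrArg (fun x : F.toSubmonoid => (x : L) * b) hga.symm
          rw [pow_succ, mul_assoc, h1, ih]
      obtain ⟨n, hn⟩ := Luk.exists_pow_le (h := a)
        (by rw [← Luk.val_lt_val, ha, Luk.val_one]; linarith) (e z)
      have hn' : (e.symm a) ^ n ≤ z := by
        rw [← map_le_map_iff e, map_pow, OrderMonoidIso.apply_symm_apply]
        exact hn
      have h2 : (g : L) * b ≤ z * b := by
        calc (g : L) * b = ((e.symm a) ^ n : L) * (g * b) := (hpow n).symm
          _ ≤ z * (g * b) := mul_le_mul_left (α := L) hn' _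
          _ ≤ z * b := by
            refine mul_le_mul_right ?_ _
            rw [mul_comm]
            exact mul_le_self' b g
      exact absurd (hresl ⟨z * b, hmR⟩ g h2) (not_le.2 (h.trans hlt))
  obtain ⟨κ, hκ⟩ : ∃ κ, κ = (e k).val := ⟨_, rfl⟩
  have hκ1 : κ < 1 := by
    by_contra hcon
    rw [not_lt, hκ] at hcon
    have hk1 : k = 1 := by
      apply EquivLike.injective e
      apply Luk.val_injective
      rw [map_one, Luk.val_one]
      exact le_antisymm (Luk.val_le_one _) hcon
    rw [hk1] at hkb
    refine hR ⟨b, Set.eq_singleton_iff_unique_mem.2 ⟨hb, fun r hr => ?_⟩⟩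
    refine le_antisymm (hmax r hr) ?_
    have := hmin r hr
    rwa [← hkb, OneMemClass.coe_one, one_mul] at this
  have hκ0 : 0 ≤ κ := hκ ▸ Luk.val_nonneg _
  have hd : 0 < 1 - κ := sub_pos.2 hκ1
  have hval : ∀ r, κ ≤ (e (res r)).val := fun r => by
    rw [hκ]; exact Luk.val_le_val.2 ((map_le_map_iff e).2 (hkres r))
  -- The residuals fill `[κ, 1]`, with `κ < 1` as the class is not a singleton; `ψ` rescales this
  -- segment to `[0,1]`.
  obtain ⟨ψ, hψ⟩ : ∃ ψ : F.cls R → Set.Icc (0 : ℝ) 1,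
      ∀ r, (ψ r : ℝ) = ((e (res r)).val - κ) / (1 - κ) :=
    ⟨fun r => ⟨((e (res r)).val - κ) / (1 - κ), div_nonneg (sub_nonneg.2 (hval r)) hd.le,
      (div_le_one hd).2 (by linarith [(e (res r)).val_le_one])⟩, fun r => rfl⟩
  have hψm : StrictMono ψ := by
    refine strictMono_of_le_iff_le fun r s => ?_
    rw [← Subtype.coe_le_coe (x := ψ r), hψ, hψ, div_le_div_iff_of_pos_right hd,
      sub_le_sub_iff_right, Luk.val_le_val, map_le_map_iff, hres_le]
  have hψs : Function.Surjective ψ := by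
    intro x
    have hx0 := x.2.1
    have hx1 := x.2.2
    have h0 : 0 ≤ x * (1 - κ) := by positivity
    have h1 : x * (1 - κ) ≤ 1 * (1 - κ) := by gcongr
    obtain ⟨a, ha⟩ := Luk.exists_val_eq (x := κ + x * (1 - κ)) (by linarith) (by linarith)
    refine ⟨⟨e.symm a * b, F.mul_mem_cls R (e.symm a).2 hb⟩, ?_⟩
    have hka : k ≤ e.symm a := by
      rw [← map_le_map_iff e, OrderMonoidIso.apply_symm_apply, ← Luk.val_le_val, ha, ← hκ]
      linarith
    apply Subtype.ext
    rw [hψ, hres_eq, max_eq_left hka, OrderMonoidIso.apply_symm_apply, ha]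
    field_simp
    ring
  -- Multiplication by `f` shifts the residual by `e f - 1` and truncates at `κ`; after rescaling,
  -- the shift has slope `1 / (1 - κ)`.
  have hψf : ∀ (f : F.toSubmonoid) (r : F.cls R),
      (ψ (F.translation R f r) : ℝ) = max (ψ r + ((e f).val - 1) / (1 - κ)) 0 := by
    intro f r
    have h1 : F.translation R f r =
        ⟨((f * res r : F.toSubmonoid) : L) * b, F.mul_mem_cls R (f * res r).2 hb⟩ := by
      apply Subtype.ext
      change (f : L) * r = (f : L) * res r * b
      rw [mul_assoc, hres]
    have h2 : ∀ x y : F.toSubmonoid, (e (max x y)).val = max (e x).val (e y).val := by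
      intro x y
      rcases le_total x y with h | h
      · rw [max_eq_right h, max_eq_right (Luk.val_le_val.2 ((map_le_map_iff e).2 h))]
      · rw [max_eq_left h, max_eq_left (Luk.val_le_val.2 ((map_le_map_iff e).2 h))]
    rw [hψ, h1, hres_eq, h2, map_mul, Luk.val_mul, ← hκ, hψ, max_assoc, max_eq_right hκ0,
      ← add_div, div_eq_iff hd.ne', max_mul_of_nonneg _ _ hd.le, div_mul_cancel₀ _ hd.ne',
      zero_mul, ← max_sub_sub_right, sub_self]
    congr 1
    ring
  let φ : F.cls R ≃o Set.Icc (0 : ℝ) 1 := hψm.orderIsoOfSurjective ψ hψs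
  have hφ : ∀ r, φ r = ψ r := fun r => rfl
  have hconj : ∀ (f : F.toSubmonoid) (s : Set.Icc (0 : ℝ) 1),
      (φ (F.translation R f (φ.symm s)) : ℝ) = max (s + ((e f).val - 1) / (1 - κ)) 0 := by
    intro f s
    rw [hφ, hψf, ← hφ, OrderIso.apply_symm_apply]
  refine ⟨φ, ?_⟩
  unfold IsCIso
  rw [carrier_PhiLuk]
  ext g
  constructor
  · rintro ⟨t, rfl⟩
    have ht0 := t.val_nonneg
    have ht1 := t.val_le_one
    have h0 : 0 ≤ t.val * (1 - κ) := by positivity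
    have h1 : t.val * (1 - κ) ≤ 1 * (1 - κ) := by gcongr
    obtain ⟨a, ha⟩ := Luk.exists_val_eq (x := κ + t.val * (1 - κ)) (by linarith) (by linarith)
    refine ⟨F.translation R (e.symm a), ⟨e.symm a, rfl⟩, fun s => Subtype.ext ?_⟩
    rw [hconj, lukParam_apply, OrderMonoidIso.apply_symm_apply, ha]
    congr 1
    field_simp
    ring
  · rintro ⟨_, ⟨f, rfl⟩, hg⟩
    have hf1 : ((e f).val - 1) / (1 - κ) ≤ 0 :=
      div_nonpos_of_nonpos_of_nonneg (sub_nonpos.2 (Luk.val_le_one _)) hd.le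
    -- All `f` with `e f ≤ κ` act as the constant `0`, so truncating the parameter does not change
    -- the map.
    obtain ⟨t, ht⟩ := Luk.exists_val_eq (x := max (1 + ((e f).val - 1) / (1 - κ)) 0)
      (le_max_right _ _) (max_le (by linarith) zero_le_one)
    refine ⟨t, ?_⟩
    apply OrderHom.ext; funext s; apply Subtype.ext
    rw [hg, hconj, lukParam_apply, ht]
    have hs := s.2.2
    simp only [max_def]
    split_ifs <;> linarith

end Existence

end Tomonoid

/-! ### The explicit formulas for `ρ_R` -/

theorem mainTheorem3 {L : Type*} [CommMonoid L] [LinearOrder L] [Tomonoid.IsQNC L]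
    (F : Tomonoid.TFilter L) (hF : F.toSubmonoid ≠ ⊥)
    (hL : Tomonoid.IsArchimedeanRealCoextension F)
    (R : F.Quot) (hR : ¬ ∃ a, F.cls R = {a}) :
    -- (i)
    (Tomonoid.IsLukasiewicz F.toSubmonoid →
      (F.Lambda R).IsLuk ∧
      ∀ (e : F.toSubmonoid ≃*o Tomonoid.Luk) (φ : F.cls R ≃o Set.Icc (0 : ℝ) 1),
        Tomonoid.IsCIso φ (F.Lambda R) Tomonoid.PhiLuk →
        ∃ α : ℝ, 1 ≤ α ∧ ∀ (f : F.toSubmonoid) (r : Set.Icc (0 : ℝ) 1),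
          (φ ((F.rho R f).1 (φ.symm r)) : ℝ) = max ((r : ℝ) + α * ((e f).val - 1)) 0) ∧
    -- (ii)
    (∀ (e : F.toSubmonoid ≃*o Set.Ioc (0 : ℝ) 1) (φ : F.cls R ≃o Set.Icc (0 : ℝ) 1),
        Tomonoid.IsCIso φ (F.Lambda R) Tomonoid.PhiLuk →
        ∃ α : ℝ, 0 < α ∧ ∀ (f : F.toSubmonoid) (r : Set.Icc (0 : ℝ) 1),
          (φ ((F.rho R f).1 (φ.symm r)) : ℝ) = max ((r : ℝ) + α * Real.log (e f : ℝ)) 0) ∧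
    -- (iii)
    (∀ (e : F.toSubmonoid ≃*o Set.Ioc (0 : ℝ) 1) (φ : F.cls R ≃o Set.Ioc (0 : ℝ) 1),
        Tomonoid.IsCIso φ (F.Lambda R) Tomonoid.PhiProd →
        ∃ α : ℝ, 0 < α ∧ ∀ (f : F.toSubmonoid) (r : Set.Ioc (0 : ℝ) 1),
          (φ ((F.rho R f).1 (φ.symm r)) : ℝ) = (e f : ℝ) ^ α * (r : ℝ)) ∧
    -- (iv)
    (∀ (e : F.toSubmonoid ≃*o Set.Ioc (0 : ℝ) 1) (φ : F.cls R ≃o Set.Ico (0 : ℝ) 1),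
        Tomonoid.IsCIso φ (F.Lambda R) Tomonoid.PhiRevProd →
        ∃ α : ℝ, 0 < α ∧ ∀ (f : F.toSubmonoid) (r : Set.Ico (0 : ℝ) 1),
          (φ ((F.rho R f).1 (φ.symm r)) : ℝ) = max (1 - (1 - (r : ℝ)) / (e f : ℝ) ^ α) 0) ∧
    -- (v)
    (∀ (e : F.toSubmonoid ≃*o Set.Ioc (0 : ℝ) 1) (φ : F.cls R ≃o Set.Ioo (0 : ℝ) 1),
        Tomonoid.IsCIso φ (F.Lambda R) Tomonoid.PhiPow →
        ∃ α : ℝ, 0 < α ∧ ∀ (f : F.toSubmonoid) (r : Set.Ioo (0 : ℝ) 1),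
          (φ ((F.rho R f).1 (φ.symm r)) : ℝ) = (r : ℝ) ^ (1 / (e f : ℝ) ^ α)) := by
  -- Replacing `F` by its standard model keeps the parameter map surjective, monotone and
  -- multiplicative.
  have hcomp : ∀ {T₁ T₂ : Type} [Mul T₁] [LinearOrder T₁] [Mul T₂] [LinearOrder T₂]
      (e : F.toSubmonoid ≃*o T₁) (τ : F.toSubmonoid → T₂), Function.Surjective τ → Monotone τ →
      (∀ f g, τ (f * g) = τ f * τ g) →
      Function.Surjective (τ ∘ e.symm) ∧ Monotone (τ ∘ e.symm) ∧
        ∀ a b, (τ ∘ e.symm) (a * b) = (τ ∘ e.symm) a * (τ ∘ e.symm) b := by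
    intro T₁ T₂ _ _ _ _ e τ hs hm hmul
    refine ⟨hs.comp e.symm.surjective, hm.comp e.symm.toOrderIso.monotone, fun a b => ?_⟩
    simp only [Function.comp_apply, map_mul, hmul]
  refine ⟨?_, ?_, ?_, ?_, ?_⟩
  · rintro ⟨e₀⟩
    refine ⟨Tomonoid.TFilter.Lambda_isLuk hR e₀, fun e φ h => ?_⟩
    obtain ⟨τ, hs, hm, hmul, hτ⟩ := h.exists_hom Tomonoid.lukParam_mul Tomonoid.le_of_lukParam_le
      Tomonoid.carrier_PhiLuk
    obtain ⟨hs', hm', hmul'⟩ := hcomp e τ hs hm hmul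
    obtain ⟨α, hα, hα'⟩ := Tomonoid.exists_luk_hom_eq hs' hm' hmul'
    refine ⟨α, hα, fun f r => ?_⟩
    have h1 := hα' (e f)
    rw [Function.comp_apply, OrderMonoidIso.symm_apply_apply] at h1
    rw [hτ, Tomonoid.lukParam_apply, h1]
    -- Because `r ≤ 1`, the inner truncation of the parameter is absorbed by the outer one.
    have hr := r.2.2
    simp only [max_def]
    split_ifs <;> linarith
  · intro e φ h
    obtain ⟨τ, hs, hm, hmul, hτ⟩ := h.exists_hom Tomonoid.lukParam_mul Tomonoid.le_of_lukParam_le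
      Tomonoid.carrier_PhiLuk
    obtain ⟨hs', hm', hmul'⟩ := hcomp e τ hs hm hmul
    obtain ⟨α, hα, hα'⟩ := Tomonoid.exists_prod_luk_hom_eq hs' hm' hmul'
    refine ⟨α, hα, fun f r => ?_⟩
    have h1 := hα' (e f)
    rw [Function.comp_apply, OrderMonoidIso.symm_apply_apply] at h1
    rw [hτ, Tomonoid.lukParam_apply, h1]
    have hr := r.2.2
    simp only [max_def]
    split_ifs <;> linarith
  · intro e φ h
    obtain ⟨τ, hs, hm, hmul, hτ⟩ := h.exists_hom Tomonoid.prodMap_mul Tomonoid.le_of_prodMap_le rfl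
    obtain ⟨hs', hm', hmul'⟩ := hcomp e τ hs hm hmul
    obtain ⟨α, hα, hα'⟩ := Tomonoid.exists_prod_hom_eq hs' hm' hmul'
    refine ⟨α, hα, fun f r => ?_⟩
    have h1 := hα' (e f)
    rw [Function.comp_apply, OrderMonoidIso.symm_apply_apply] at h1
    rw [hτ]
    change (τ f : ℝ) * r = _
    rw [h1]
  · intro e φ h
    obtain ⟨τ, hs, hm, hmul, hτ⟩ := h.exists_hom Tomonoid.revProdMap_mul Tomonoid.le_of_revProdMap_le rfl
    obtain ⟨hs', hm', hmul'⟩ := hcomp e τ hs hm hmul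
    obtain ⟨α, hα, hα'⟩ := Tomonoid.exists_prod_hom_eq hs' hm' hmul'
    refine ⟨α, hα, fun f r => ?_⟩
    have h1 := hα' (e f)
    rw [Function.comp_apply, OrderMonoidIso.symm_apply_apply] at h1
    rw [hτ]
    rw [Tomonoid.revProdMap_apply, h1]
  · intro e φ h
    obtain ⟨τ, hs, hm, hmul, hτ⟩ := h.exists_hom Tomonoid.powMap_mul Tomonoid.le_of_powMap_le rfl
    obtain ⟨hs', hm', hmul'⟩ := hcomp e τ hs hm hmul
    obtain ⟨α, hα, hα'⟩ := Tomonoid.exists_prod_hom_eq hs' hm' hmul'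
    refine ⟨α, hα, fun f r => ?_⟩
    have h1 := hα' (e f)
    rw [Function.comp_apply, OrderMonoidIso.symm_apply_apply] at h1
    rw [hτ]
    change (r : ℝ) ^ (1 / (τ f : ℝ)) = _
    rw [h1]
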